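/- Let $(R,\mathfrak m)$ be a commutative Noetherian local ring and let $N$ be a non-zero finitely generated $R$-module such that $\dim N>0$ and $\operatorname{Ass}_R N$ has at least two elements. Then there exists an ideal $I$ of $R$ with $N/IN\neq 0$ (that is, $I$ is $N$-proper) such that $$\mathfrak m\in Q(I,N)\setminus \operatorname{mAss}_R N/IN .$$ Here, for an $R$-module $L$, $\operatorname{mAss}_R L$ denotes the set of minimal elements (under inclusion) of $\operatorname{Ass}_R L$; and $Q(I,N)$ (the quintessential primes of $I$ with respect to $N$) denotes the set of prime ideals $\mathfrak p$ of $R$ for which there exists $\mathfrak q\in\operatorname{Ass}_{R^*_{\mathfrak p}}N^*_{\mathfrak p}$ with $\operatorname{Rad}(IR^*_{\mathfrak p}+\mathfrak q)=\mathfrak pR^*_{\mathfrak p}$, where $R^*_{\mathfrak p}$ and $N^*_{\mathfrak p}$ are the completions of $R_{\mathfrak p}$ and $N_{\mathfrak p}$ in the $\mathfrak pR_{\mathfrak p}$-adic topology. -/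

import Mathlib

universe u v

/-- `mAss_R L`: the minimal elements, under inclusion, of the set `Ass_R L` of associated primes
of the `R`-module `L`. -/
def minimalAssociatedPrimes (R : Type u) [CommRing R] (L : Type v) [AddCommGroup L] [Module R L] :
    Set (Ideal R) :=
  {p | Minimal (fun q : Ideal R => q ∈ associatedPrimes R L) p}

/-- An ideal `J` of `R` is `N`-proper if `N / JN ≠ 0`. -/
def Ideal.IsModuleProper {R : Type u} [CommRing R] (J : Ideal R)
    (N : Type v) [AddCommGroup N] [Module R N] : Prop :=
  Nontrivial (N ⧸ (J • ⊤ : Submodule R N))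

/-- The ring `R_p^*`: the completion of the local ring `R_p` with respect to its maximal ideal. -/
abbrev LocalCompletionRing (R : Type u) [CommRing R] (p : Ideal R) [p.IsPrime] : Type u :=
  AdicCompletion (IsLocalRing.maximalIdeal (Localization.AtPrime p)) (Localization.AtPrime p)

/-- The `R_p^*`-module `N_p^*`: the completion of the localized module `N_p` with respect to the
maximal ideal of `R_p`. -/
abbrev LocalCompletionModule (R : Type u) [CommRing R] (p : Ideal R) [p.IsPrime]
    (N : Type v) [AddCommGroup N] [Module R N] : Type (max u v) :=
  AdicCompletion (IsLocalRing.maximalIdeal (Localization.AtPrime p))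
    (LocalizedModule.AtPrime p N)

/-- `Q(I, N)`: the set of quintessential primes of `I` with respect to `N`, that is, the primes
`p` of `R` such that `Rad(I R_p^* + q) = p R_p^*` for some `q ∈ Ass N_p^*` (over `R_p^*`). -/
def quintessentialPrimes {R : Type u} [CommRing R] (I : Ideal R)
    (N : Type v) [AddCommGroup N] [Module R N] : Set (Ideal R) :=
  {p | ∃ _ : p.IsPrime,
    ∃ q ∈ associatedPrimes (LocalCompletionRing R p) (LocalCompletionModule R p N),
      (I.map (algebraMap R (LocalCompletionRing R p)) ⊔ q).radical =
        p.map (algebraMap R (LocalCompletionRing R p))}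

/-! Choose associated primes p, q of N with p not inside q, and take for I a prime P maximal among
those containing q but not p. Krull's principal ideal theorem forces P + p to be primary to the
maximal ideal m. If p = ann x, then x survives in the completion, where Noetherianity puts its
annihilator inside an associated prime; that prime contains the extension of p, so m is
quintessential for P. Since q ≤ P, the prime P lies in the support of N/PN, and P ≠ m, so m is not
minimal. -/

theorem AdicCompletion.factorPow_comp_quotientMap_comp_evalₐ {P R : Type*} [CommRing P]
    [CommRing R] (J : Ideal P) (I : Ideal R) (f : P →+* R)
    (hf : ∀ n : ℕ, J ^ n ≤ (I ^ n).comap f) {m n : ℕ} (hmn : m ≤ n) :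
    (Ideal.Quotient.factorPow I hmn).comp ((Ideal.quotientMap (I ^ n) f (hf n)).comp
      (AdicCompletion.evalₐ J n : AdicCompletion J P →+* P ⧸ J ^ n)) =
    (Ideal.quotientMap (I ^ m) f (hf m)).comp
      (AdicCompletion.evalₐ J m : AdicCompletion J P →+* P ⧸ J ^ m) := by
  ext x
  induction x using AdicCompletion.induction_on with
  | _ a =>
  simp only [RingHom.coe_comp, Function.comp_apply, RingHom.coe_coe, AdicCompletion.evalₐ_mk,
    Ideal.quotientMap_mk]
  have h : Ideal.Quotient.mk (J ^ m) (a.1 n) = Ideal.Quotient.mk (J ^ m) (a.1 m) :=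
    AdicCompletion.Ideal.mk_eq_mk J hmn a
  rw [Ideal.Quotient.eq] at h
  change Ideal.Quotient.mk (I ^ m) (f (a.1 n)) = Ideal.Quotient.mk (I ^ m) (f (a.1 m))
  rw [Ideal.Quotient.eq, ← map_sub]
  exact hf m h

/-- The ring homomorphism between adic completions induced by a ring homomorphism `f : P →+* R`
carrying the ideal `J` into the ideal `I`. -/
noncomputable def AdicCompletion.mapRingHom {P R : Type*} [CommRing P] [CommRing R] (J : Ideal P)
    (I : Ideal R) (f : P →+* R) (hf : J ≤ I.comap f) : AdicCompletion J P →+* AdicCompletion I R :=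
  AdicCompletion.liftRingHom I _ (AdicCompletion.factorPow_comp_quotientMap_comp_evalₐ J I f
    fun n => (Ideal.pow_right_mono hf n).trans (Ideal.le_comap_pow f n))

theorem AdicCompletion.mapRingHom_algebraMap {P R : Type*} [CommRing P] [CommRing R] (J : Ideal P)
    (I : Ideal R) (f : P →+* R) (hf : J ≤ I.comap f) (x : P) :
    AdicCompletion.mapRingHom J I f hf (algebraMap P _ x) = algebraMap R _ (f x) := by
  apply AdicCompletion.ext_evalₐ
  intro n
  refine (AdicCompletion.evalₐ_liftRingHom I _
    (AdicCompletion.factorPow_comp_quotientMap_comp_evalₐ J I f _) n _).trans ?_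
  simp

/-- Successive approximation: the map is onto modulo the extended ideal, the source is complete and
the target Hausdorff. -/
theorem AdicCompletion.mapRingHom_surjective {P R : Type*} [CommRing P] [CommRing R] (J : Ideal P)
    (f : P →+* R) (hf : Function.Surjective f) (hJ : J.FG) :
    Function.Surjective (AdicCompletion.mapRingHom J (J.map f) f Ideal.le_comap_map) := by
  set I := J.map f
  set φ := AdicCompletion.mapRingHom J I f Ideal.le_comap_map
  have hI : I.FG := hJ.map f
  have := AdicCompletion.isAdicComplete_self J hJ
  have := AdicCompletion.isAdicComplete_self I hI
  have hmap : (J.map (algebraMap P (AdicCompletion J P))).map φ =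
      I.map (algebraMap R (AdicCompletion I R)) := by
    rw [Ideal.map_map, Ideal.map_map]
    exact congrArg (Ideal.map · J)
      (RingHom.ext fun x => AdicCompletion.mapRingHom_algebraMap J I f Ideal.le_comap_map x)
  have : IsHausdorff ((J.map (algebraMap P (AdicCompletion J P))).map φ) (AdicCompletion I R) := by
    rw [hmap]; infer_instance
  apply surjective_of_mk_map_comp_surjective (I := J.map (algebraMap P (AdicCompletion J P)))
  intro y
  obtain ⟨y, rfl⟩ := Ideal.Quotient.mk_surjective y
  obtain ⟨r, hr⟩ := Ideal.Quotient.mk_surjective (AdicCompletion.evalOneₐ I y)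
  obtain ⟨p, rfl⟩ := hf r
  refine ⟨algebraMap P _ p, ?_⟩
  rw [RingHom.comp_apply, Ideal.Quotient.eq, AdicCompletion.mapRingHom_algebraMap, hmap,
    ← AdicCompletion.ker_evalOneₐ_eq_map I hI, RingHom.mem_ker, map_sub, sub_eq_zero]
  exact hr

/-- Sending variables to generators of `I` makes the completion a quotient of a power series ring
over `R`. -/
instance AdicCompletion.isNoetherianRing {R : Type*} [CommRing R] [IsNoetherianRing R]
    (I : Ideal R) : IsNoetherianRing (AdicCompletion I R) := by
  obtain ⟨n, s, hs⟩ := Submodule.fg_iff_exists_fin_generating_family.mp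
    (IsNoetherian.noetherian I)
  let f : MvPolynomial (Fin n) R →+* R := (MvPolynomial.aeval (R := R) s).toRingHom
  have hf : Function.Surjective f := fun r => ⟨MvPolynomial.C r, by simp [f]⟩
  have hI : (MvPolynomial.idealOfVars (Fin n) R).map f = I := by
    rw [MvPolynomial.idealOfVars, Ideal.map_span, ← hs, ← Set.range_comp]
    congr 2
    ext i
    simp [f]
  have : IsNoetherianRing
      (AdicCompletion (MvPolynomial.idealOfVars (Fin n) R) (MvPolynomial (Fin n) R)) :=
    isNoetherianRing_of_ringEquiv _ (MvPowerSeries.toAdicCompletionAlgEquiv (Fin n) R).toRingEquiv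
  subst hI
  exact isNoetherianRing_of_surjective _ _ _
    (AdicCompletion.mapRingHom_surjective _ f hf (MvPolynomial.idealOfVars_fg (Fin n) R))

theorem Ideal.exists_prime_radical_sup_eq_maximalIdeal {R : Type*} [CommRing R]
    [IsNoetherianRing R] [IsLocalRing R] (p q : Ideal R) (hp : p ≠ ⊤) [q.IsPrime] (hpq : ¬ p ≤ q) :
    ∃ P : Ideal R, P.IsPrime ∧ q ≤ P ∧ ¬ p ≤ P ∧
      (P ⊔ p).radical = IsLocalRing.maximalIdeal R := by
  obtain ⟨(P : Ideal R), ⟨hP, hqP, hpP⟩, hmax⟩ := set_has_maximal_iff_noetherian.mpr ‹IsNoetherianRing R›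
    {P : Ideal R | P.IsPrime ∧ q ≤ P ∧ ¬ p ≤ P} ⟨q, ‹_›, le_rfl, hpq⟩
  refine ⟨P, hP, hqP, hpP, ?_⟩
  have hlt (Q : Ideal R) (hQ : Q.IsPrime) (h : P < Q) : p ≤ Q := by
    by_contra hn
    exact hmax Q ⟨hQ, hqP.trans h.le, hn⟩ h
  have hle : P ⊔ p ≤ IsLocalRing.maximalIdeal R :=
    sup_le (IsLocalRing.le_maximalIdeal hP.ne_top) (IsLocalRing.le_maximalIdeal hp)
  -- Otherwise prime avoidance gives `x` in the maximal ideal outside every minimal prime of `P ⊔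
  -- p`. A prime `Q` minimal over `P + (x)` contains `p` by maximality of `P`, hence contains some
  -- such minimal prime `w`. The chain `P < w < Q` contradicts Krull's theorem.
  have hmem : ∃ w ∈ (P ⊔ p).minimalPrimes, IsLocalRing.maximalIdeal R ≤ w := by
    by_contra! hw
    -- `w₀` serves only to show that `x` is not in `P`.
    obtain ⟨w₀, hw₀, -⟩ := Ideal.exists_minimalPrimes_le hle
    have hfin : (P ⊔ p).minimalPrimes.Finite := Ideal.finite_minimalPrimes_of_isNoetherianRing R _
    have hnot : ¬ ((IsLocalRing.maximalIdeal R : Set R) ⊆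
        ⋃ w ∈ (hfin.toFinset : Set (Ideal R)), (w : Set R)) := by
      intro hsub
      obtain ⟨w, hw', h⟩ := (Ideal.subset_union_prime (f := id) ⊥ ⊥
        (fun w hw _ _ => (hfin.mem_toFinset.mp hw).isPrime)).mp hsub
      exact hw w (hfin.mem_toFinset.mp hw') h
    obtain ⟨x, hx, hxw⟩ := Set.not_subset.mp hnot
    simp only [Set.mem_iUnion, Finset.mem_coe, hfin.mem_toFinset, not_exists] at hxw
    obtain ⟨Q, hQ, -⟩ := Ideal.exists_minimalPrimes_le
      (show P ⊔ Ideal.span {x} ≤ IsLocalRing.maximalIdeal R from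
        sup_le (le_sup_left.trans hle) ((Ideal.span_singleton_le_iff_mem _).mpr hx))
    have hQp := hQ.isPrime
    have hxQ : x ∈ Q := hQ.1.2 (Ideal.mem_sup_right (Ideal.mem_span_singleton_self x))
    have hPQ : P < Q := lt_of_le_of_ne (le_sup_left.trans hQ.1.2) (by
      rintro rfl
      exact hxw w₀ hw₀ (hw₀.1.2 (Ideal.mem_sup_left hxQ)))
    obtain ⟨w, hw', hwQ⟩ := Ideal.exists_minimalPrimes_le (sup_le hPQ.le (hlt Q hQp hPQ))
    have hwp := hw'.isPrime
    have hPw : P < w := lt_of_le_of_ne (le_sup_left.trans hw'.1.2) (by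
      rintro rfl
      exact hpP (le_sup_right.trans hw'.1.2))
    have hwQ : w < Q := lt_of_le_of_ne hwQ (by
      rintro rfl
      exact hxw w hw' hxQ)
    have hmin := Ideal.mem_minimalPrimes_span_of_mem_minimalPrimes_span_insert hwQ x P
      (by rwa [Ideal.span_insert, Ideal.span_eq, sup_comm]) P hPw.le
      (fun y hy => Ideal.le_radical (Ideal.subset_span (Or.inr hy)))
    rw [Ideal.span_eq] at hmin
    exact hPw.not_ge (hmin.2 ⟨hP, le_rfl⟩ hPw.le)
  obtain ⟨w, hw, hmw⟩ := hmem
  apply le_antisymm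
  · exact (Ideal.IsPrime.radical_le_iff inferInstance).mpr hle
  · rw [Ideal.radical_eq_sInf]
    refine le_sInf fun Q hQ => ?_
    have := hw.2 ⟨hQ.2, hQ.1⟩
      ((IsLocalRing.le_maximalIdeal hQ.2.ne_top).trans hmw)
    exact hmw.trans this

open IsLocalRing in
-- `P` lies in Supp N ∩ V(P), the support of the quotient, so it contains a minimal prime of that
-- support. Such a prime is associated and strictly below the maximal ideal.
theorem maximalIdeal_notMem_minimalAssociatedPrimes_quotient {R : Type u} [CommRing R]
    [IsNoetherianRing R] [IsLocalRing R] {N : Type v} [AddCommGroup N] [Module R N]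
    [Module.Finite R N] {P : Ideal R} (hP : P.IsPrime) (hPm : P ≠ maximalIdeal R)
    (hann : Module.annihilator R N ≤ P) :
    maximalIdeal R ∉ minimalAssociatedPrimes R (N ⧸ (P • ⊤ : Submodule R N)) := by
  intro hmin
  have hsupp : (⟨P, hP⟩ : PrimeSpectrum R) ∈
      Module.support R (N ⧸ (P • ⊤ : Submodule R N)) := by
    rw [Module.support_quotient]
    exact ⟨Module.mem_support_iff_of_finite.mpr hann, (PrimeSpectrum.mem_zeroLocus _ _).mpr subset_rfl⟩
  obtain ⟨w, hw, hwP⟩ := Ideal.exists_minimalPrimes_le (Module.mem_support_iff_of_finite.mp hsupp)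
  have hwass := Module.associatedPrimes.minimalPrimes_annihilator_subset_associatedPrimes R _ hw
  exact hPm (le_antisymm (le_maximalIdeal hP.ne_top)
    ((hmin.2 hwass (hwP.trans (le_maximalIdeal hP.ne_top))).trans hwP))

open IsLocalRing in
theorem exists_associatedPrime_localCompletionModule_map_le {R : Type u} [CommRing R]
    [IsNoetherianRing R] [IsLocalRing R] {N : Type v} [AddCommGroup N] [Module R N]
    [Module.Finite R N] {p : Ideal R} (hp : p ∈ associatedPrimes R N) :
    ∃ q ∈ associatedPrimes (LocalCompletionRing R (maximalIdeal R))
        (LocalCompletionModule R (maximalIdeal R) N),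
      p.map (algebraMap R (LocalCompletionRing R (maximalIdeal R))) ≤ q := by
  obtain ⟨hprime, x, hx⟩ := isAssociatedPrime_iff.mp hp
  set m := maximalIdeal R
  set S := Localization.AtPrime m
  set M := LocalizedModule.AtPrime m N
  have hmem (r : R) : r ∈ p ↔ r • x = 0 := by
    rw [hx, Submodule.mem_colon_singleton, Submodule.mem_bot]
  have hx0 : LocalizedModule.mkLinearMap m.primeCompl N x ≠ 0 := by
    intro h
    obtain ⟨c, hc⟩ := (IsLocalizedModule.eq_zero_iff m.primeCompl _).mp h
    exact c.2 (le_maximalIdeal hprime.ne_top ((hmem c).mpr hc))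
  set y : LocalCompletionModule R m N := AdicCompletion.of (maximalIdeal S) M
    (LocalizedModule.mkLinearMap m.primeCompl N x) with hy
  have hy0 : y ≠ 0 := fun h =>
    hx0 (AdicCompletion.of_injective (maximalIdeal S) M (h.trans (map_zero _).symm))
  -- Uses that the completed ring is Noetherian; no finiteness of the completed module is needed.
  obtain ⟨q, hq, hle⟩ :=
    exists_le_isAssociatedPrime_of_isNoetherianRing (LocalCompletionRing R m) y hy0
  refine ⟨q, hq, Ideal.map_le_iff_le_comap.mpr fun r hr => hle ?_⟩
  rw [Submodule.mem_colon_singleton, Submodule.mem_bot,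
    IsScalarTower.algebraMap_apply R S (LocalCompletionRing R m), algebraMap_smul, hy,
    ← map_smul, algebraMap_smul, ← map_smul, (hmem r).mp hr, map_zero, map_zero]

open IsLocalRing in
theorem isMaximal_map_localCompletionRing (R : Type u) [CommRing R] [IsNoetherianRing R]
    [IsLocalRing R] : ((maximalIdeal R).map
      (algebraMap R (LocalCompletionRing R (maximalIdeal R)))).IsMaximal := by
  rw [IsScalarTower.algebraMap_eq R (Localization.AtPrime (maximalIdeal R)), ← Ideal.map_map,
    Localization.AtPrime.map_eq_maximalIdeal]
  exact AdicCompletion.isMaximal_map_of_le _ _ le_rfl (Ideal.fg_of_isNoetherianRing _)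

open IsLocalRing in
theorem maximalIdeal_mem_quintessentialPrimes {R : Type u} [CommRing R]
    [IsNoetherianRing R] [IsLocalRing R] {N : Type v} [AddCommGroup N] [Module R N]
    [Module.Finite R N] {I p : Ideal R} (hp : p ∈ associatedPrimes R N)
    (hI : (I ⊔ p).radical = maximalIdeal R) : maximalIdeal R ∈ quintessentialPrimes I N := by
  obtain ⟨q, hq, hpq⟩ := exists_associatedPrime_localCompletionModule_map_le hp
  refine ⟨inferInstance, q, hq, ?_⟩
  have hmax := isMaximal_map_localCompletionRing R
  have hloc : IsLocalRing (LocalCompletionRing R (maximalIdeal R)) := inferInstance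
  have hmax_eq := eq_maximalIdeal hmax
  have hIm : I ≤ maximalIdeal R := le_sup_left.trans (Ideal.le_radical.trans hI.le)
  apply le_antisymm
  · rw [hmax.isPrime.radical_le_iff]
    exact sup_le (Ideal.map_mono hIm) (hmax_eq ▸ le_maximalIdeal hq.isPrime.ne_top)
  · refine (Ideal.map_mono hI.ge).trans ((Ideal.map_radical_le _).trans (Ideal.radical_mono ?_))
    rw [Ideal.map_sup]
    exact sup_le_sup_left hpq _

theorem proposition4p2 (R : Type u) [CommRing R] [IsNoetherianRing R] [IsLocalRing R]
    (N : Type v) [AddCommGroup N] [Module R N] [Nontrivial N] [Module.Finite R N]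
    (hdim : 0 < Module.supportDim R N)
    (hass : (associatedPrimes R N).Nontrivial) :
    ∃ I : Ideal R, I.IsModuleProper N ∧
      IsLocalRing.maximalIdeal R ∈
        quintessentialPrimes I N \ minimalAssociatedPrimes R (N ⧸ (I • ⊤ : Submodule R N)) := by
  obtain ⟨p, hp, q, hq, hpq⟩ : ∃ p ∈ associatedPrimes R N, ∃ q ∈ associatedPrimes R N, ¬ p ≤ q := by
    obtain ⟨p, hp, q, hq, hne⟩ := hass
    by_cases h : p ≤ q
    · exact ⟨q, hq, p, hp, fun h' => hne (le_antisymm h h')⟩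
    · exact ⟨p, hp, q, hq, h⟩
  have := hq.isPrime
  obtain ⟨P, hP, hqP, hpP, hrad⟩ :=
    Ideal.exists_prime_radical_sup_eq_maximalIdeal p q hp.isPrime.ne_top hpq
  refine ⟨P, ?_, maximalIdeal_mem_quintessentialPrimes hp hrad,
    maximalIdeal_notMem_minimalAssociatedPrimes_quotient hP ?_ ?_⟩
  -- Nakayama's lemma.
  · refine Submodule.Quotient.nontrivial_iff.mpr (Ne.symm ?_)
    exact Submodule.top_ne_ideal_smul_of_le_jacobson_annihilator
      ((IsLocalRing.le_maximalIdeal hP.ne_top).trans (IsLocalRing.maximalIdeal_le_jacobson _))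
  · rintro rfl
    exact hpP (IsLocalRing.le_maximalIdeal hp.isPrime.ne_top)
  · rw [← Submodule.annihilator_top]
    exact hq.annihilator_le.trans hqP
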